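/- All graphs are finite and simple. Let $B=(V,E)$ be a bicyclic graph, i.e. a connected graph with $|E|=|V|+1$. Fix any orientation of the edges of $B$, and let $A_B$ be the real matrix with rows indexed by $E$ and columns indexed by $V\cup E$ given, for an edge $e$ oriented from $u$ to $v$ and $y\in V\cup E$, by $$A_B[e,y]=\begin{cases}1 & \text{if } y=v, \text{ or } y\neq e \text{ is an edge incident to } v,\\ -1 & \text{if } y=u, \text{ or } y\neq e \text{ is an edge incident to } u,\\ 0 & \text{otherwise.}\end{cases}$$ For a real matrix $A$, the permanent index $\mathrm{pind}(A)$ is the least integer $k$ for which there is a square matrix $A'$ with $\mathrm{per}(A')\neq 0$ such that each column of $A'$ is a column of $A$ and each column of $A$ occurs in $A'$ at most $k$ times (columns being counted by their index). Then $$\mathrm{pind}(A_B)=1 .$$ Moreover, $B$ is $(2,2)$-choosable: for every assignment $L$ of a set $L(z)$ of two real numbers to each $z\in V\cup E$, there is a map $f:V\cup E\to\mathbb{R}$ with $f(z)\in L(z)$ for all $z\in V\cup E$ such that, for any two adjacent vertices $u,v$, $$f(u)+\sum_{e\ni u}f(e)\neq f(v)+\sum_{e\ni v}f(e),$$ where the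 sums are over the edges incident to $u$ and to $v$, respectively. -/

import Mathlib

namespace TotalWeight

/-- The set of natural numbers `k` such that some square matrix with non-zero permanent has all
its columns among the columns of `A`, each column of `A` being used at most `k` times. The square
matrix is given by the function `c` telling which column of `A` stands at each place. -/
def columnMultiplicities {m n : Type*} [Fintype m] [DecidableEq m] [DecidableEq n]
    (A : Matrix m n ℝ) : Set ℕ :=
  {k | ∃ c : m → n, (A.submatrix id c).permanent ≠ 0 ∧
    ∀ j : n, (Finset.univ.filter (fun i : m => c i = j)).card ≤ k}

/-- The permanent index of `A`: the least `k` in `columnMultiplicities A`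
(and `⊤` if there is no such `k`). -/
noncomputable def pind {m n : Type*} [Fintype m] [DecidableEq m] [DecidableEq n]
    (A : Matrix m n ℝ) : ℕ∞ :=
  ⨅ k ∈ columnMultiplicities A, (k : ℕ∞)

/-- An orientation of a simple graph: every edge `e` gets a tail and a head, so that `e` is
oriented from `tail e` to `head e`. -/
structure Orientation {V : Type*} (G : SimpleGraph V) where
  /-- the initial vertex of an edge -/
  tail : G.edgeSet → V
  /-- the terminal vertex of an edge -/
  head : G.edgeSet → V
  /-- the two ends of the edge are its tail and its head -/
  ends : ∀ e : G.edgeSet, (e : Sym2 V) = s(tail e, head e)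

/-- The element `y` of `V ∪ E` is the vertex `v`, or it is an edge other than `e` that is
incident to `v`. -/
def Meets {V : Type*} {G : SimpleGraph V} (e : G.edgeSet) (v : V) : V ⊕ G.edgeSet → Prop
  | Sum.inl w => w = v
  | Sum.inr f => f ≠ e ∧ v ∈ (f : Sym2 V)

/-- The matrix `A_G` of an oriented graph, with rows indexed by the edges and columns indexed by
the vertices and edges. -/
noncomputable def matrixA {V : Type*} {G : SimpleGraph V} (D : Orientation G) :
    Matrix G.edgeSet (V ⊕ G.edgeSet) ℝ :=
  open Classical in
  Matrix.of fun e y =>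
    if Meets e (D.head e) y then 1
    else if Meets e (D.tail e) y then -1
    else 0

section Weighting

variable {V : Type*} [Fintype V] [DecidableEq V] (G : SimpleGraph V) [DecidableRel G.Adj]

/-- The weight `s(v) = f(v) + ∑ f(e)` of a vertex, the sum being over the edges incident
to `v`. -/
def weight (f : V ⊕ G.edgeSet → ℝ) (v : V) : ℝ :=
  f (Sum.inl v) +
    ∑ e ∈ Finset.univ.filter (fun e : G.edgeSet => v ∈ (e : Sym2 V)), f (Sum.inr e)

/-- A total weighting is proper if adjacent vertices have different weights. -/
def IsProper (f : V ⊕ G.edgeSet → ℝ) : Prop :=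
  ∀ u v : V, G.Adj u v → weight G f u ≠ weight G f v

/-- Total weight `ψ`-choosability. -/
def IsPsiChoosable (ψ : V ⊕ G.edgeSet → ℕ) : Prop :=
  ∀ L : V ⊕ G.edgeSet → Finset ℝ, (∀ z, (L z).card = ψ z) →
    ∃ f : V ⊕ G.edgeSet → ℝ, (∀ z, f z ∈ L z) ∧ IsProper G f

/-- Total weight `(k, k')`-choosability: lists of size `k` on vertices and `k'` on edges. -/
def IsChoosable (k k' : ℕ) : Prop :=
  IsPsiChoosable G (Sum.elim (fun _ => k) (fun _ => k'))

/-- A bicyclic graph: a connected graph with one more edge than vertices. -/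
def IsBicyclic : Prop :=
  G.Connected ∧ G.edgeFinset.card = Fintype.card V + 1

end Weighting

end TotalWeight

/-!
The coefficient of a squarefree monomial in the product of the rows of a matrix is a permanent of
a square matrix made of distinct columns; by the Combinatorial Nullstellensatz it also controls
choosability from lists of size two. So both claims follow once some squarefree coefficient is
non-zero for `A_B`. Now `A_B` factors through the vertex-element incidence matrix, and for the
apolar pairing (multiplication by `x_v` is adjoint to `∂/∂x_v`) this turns the coefficient at a
set `S` of vertices and edges into the pairing of the product over `S` of the forms `x_v`
(vertices) and `x_u + x_v` (edges) with the graph polynomial `∏ (x_u - x_v)`.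

The set `S` is found by building `B` one vertex at a time. Adding a vertex `v` with `d` earlier
neighbours permits multiplying the product by `x_v ^ d`, the pairing being multiplied by `± d!`.
Since `x_v = (x_v + x_u) - x_u`, all but one of the factors `x_v` can then be exchanged, for
distinct such neighbours `u` of `v`, for the edge `vu` or the vertex `u`, provided the vertices `u`
are still free. Hence one must keep up to two vertices free, which is possible in trees (two
non-adjacent vertices) and in unicyclic graphs (any one vertex). In a tree, omitting one vertex from
the product of all variables gives a non-zero pairing whose sign alternates along edges; this
settles the cases in which a cycle is closed.
-/

open MvPolynomial Matrix

namespace TotalWeight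

section Pairing

variable {R σ : Type*}

section CommSemiring

variable [CommSemiring R]

/-- The apolar bilinear form: distinct monomials are orthogonal, and the monomial of exponent `s`
pairs with itself to `∏ v, (s v)!`. It makes multiplication by `X v` adjoint to `∂/∂v`. -/
noncomputable def pairing : MvPolynomial σ R →ₗ[R] MvPolynomial σ R →ₗ[R] R :=
  (basisMonomials σ R).constr R fun s => s.prod (fun _ k => (k.factorial : R)) • lcoeff R s

theorem pairing_monomial (s : σ →₀ ℕ) (g : MvPolynomial σ R) :
    pairing (monomial s 1) g = s.prod (fun _ k => (k.factorial : R)) * coeff s g := by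
  rw [pairing, ← congrFun (coe_basisMonomials σ R) s, Module.Basis.constr_basis]
  rfl

theorem pairing_C (r : R) (g : MvPolynomial σ R) :
    pairing (C r) g = r * constantCoeff g := by
  rw [← mul_one (C r), C_mul', map_smul, LinearMap.smul_apply, ← C_1, C_apply, pairing_monomial,
    Finsupp.prod_zero_index, one_mul, smul_eq_mul, constantCoeff_eq]

theorem sum_single_one_apply_le_one (S : Finset σ) (v : σ) :
    (∑ i ∈ S, Finsupp.single i 1 : σ →₀ ℕ) v ≤ 1 := by
  classical
  simp only [Finsupp.finsetSum_apply, Finsupp.single_apply, Finset.sum_ite_eq']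
  split_ifs <;> simp

theorem pairing_prod_X (S : Finset σ) (g : MvPolynomial σ R) :
    pairing (∏ v ∈ S, X v) g = coeff (∑ v ∈ S, Finsupp.single v 1) g := by
  have prod_X : ∏ v ∈ S, (X v : MvPolynomial σ R) = monomial (∑ v ∈ S, Finsupp.single v 1) 1 :=
    (monomial_sum_one _ _).symm
  rw [prod_X, pairing_monomial, Finsupp.prod, Finset.prod_eq_one, one_mul]
  intro v _
  rw [Nat.factorial_eq_one.2 (sum_single_one_apply_le_one S v), Nat.cast_one]

theorem pairing_comm (f g : MvPolynomial σ R) : pairing f g = pairing g f := by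
  suffices pairing = (pairing (R := R) (σ := σ)).flip by
    rw [← LinearMap.flip_apply, ← this]
  refine (basisMonomials σ R).ext fun s => (basisMonomials σ R).ext fun t => ?_
  classical
  simp only [coe_basisMonomials, LinearMap.flip_apply, pairing_monomial, coeff_monomial]
  split_ifs <;> simp_all

theorem pairing_X_mul (v : σ) (f g : MvPolynomial σ R) :
    pairing (X v * f) g = pairing f (pderiv v g) := by
  suffices pairing ∘ₗ LinearMap.mulLeft R (X v) =
      (pairing (R := R) (σ := σ)).compl₂ (pderiv v).toLinearMap from
    LinearMap.congr_fun (LinearMap.congr_fun this f) g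
  refine (basisMonomials σ R).ext fun s => LinearMap.ext fun g => ?_
  have factorial_succ : (s + Finsupp.single v 1).prod (fun _ k => (k.factorial : R)) =
      (s v + 1) * s.prod fun _ k => (k.factorial : R) := by
    have factorial_zero (_ : σ) : ((0).factorial : R) = 1 := by simp
    rw [← Finsupp.mul_prod_erase' (s + _) v _ factorial_zero,
      ← Finsupp.mul_prod_erase' s v _ factorial_zero, Finsupp.erase_add, Finsupp.erase_single,
      add_zero, Finsupp.add_apply, Finsupp.single_eq_same, Nat.factorial_succ]
    push_cast
    ring
  simp only [coe_basisMonomials, LinearMap.comp_apply, LinearMap.mulLeft_apply,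
    LinearMap.compl₂_apply, Derivation.coeFn_coe, X, monomial_mul, mul_one,
    add_comm (Finsupp.single v 1) s, pairing_monomial, coeff_pderiv, factorial_succ]
  ring

theorem pairing_mul_X (v : σ) (f g : MvPolynomial σ R) :
    pairing f (X v * g) = pairing (pderiv v f) g := by
  rw [pairing_comm, pairing_X_mul, pairing_comm]

theorem pairing_X_mul_eq_zero {v : σ} {g : MvPolynomial σ R} (h : pderiv v g = 0)
    (f : MvPolynomial σ R) : pairing (X v * f) g = 0 := by
  rw [pairing_X_mul, h, map_zero]

theorem pderiv_bind₁ {τ : Type*} [Fintype σ] (φ : σ → MvPolynomial τ R) (j : τ)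
    (f : MvPolynomial σ R) :
    pderiv j (bind₁ φ f) = ∑ i, pderiv j (φ i) * bind₁ φ (pderiv i f) := by
  classical
  induction f using MvPolynomial.induction_on with
  | C a => simp
  | add p q hp hq => simp only [map_add, hp, hq, mul_add, Finset.sum_add_distrib]
  | mul_X p k hp =>
    simp only [map_mul, Derivation.leibniz, hp, bind₁_X_right, smul_eq_mul, pderiv_X, map_add,
      mul_add, Finset.sum_add_distrib, Finset.mul_sum]
    congr 1
    · rw [Finset.sum_eq_single k]
      · simp [mul_comm]
      · intro i _ hik
        simp [hik.symm]
      · simp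
    · exact Finset.sum_congr rfl fun i _ => by ring

variable {τ : Type*} [Fintype τ] (M : Matrix σ τ R)

theorem toMvPolynomial_eq_sum (i : σ) : M.toMvPolynomial i = ∑ j, C (M i j) * X j := by
  simp only [Matrix.toMvPolynomial, C_mul_X_eq_monomial]

theorem pderiv_toMvPolynomial (i : σ) (j : τ) : pderiv j (M.toMvPolynomial i) = C (M i j) := by
  classical
  simp [toMvPolynomial_eq_sum, pderiv_X, Pi.single_apply]

theorem pairing_bind₁_toMvPolynomial [Fintype σ] (f : MvPolynomial τ R) (g : MvPolynomial σ R) :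
    pairing (bind₁ M.transpose.toMvPolynomial f) g = pairing f (bind₁ M.toMvPolynomial g) := by
  induction f using MvPolynomial.induction_on generalizing g with
  | C r =>
    have constantCoeff_bind₁ : constantCoeff (bind₁ M.toMvPolynomial g) = constantCoeff g := by
      suffices constantCoeff.comp (bind₁ M.toMvPolynomial : _ →+* MvPolynomial τ R) =
          constantCoeff from RingHom.congr_fun this g
      exact ringHom_ext (fun r => by simp) fun i => by simp
    rw [bind₁_C_right, pairing_C, pairing_C, constantCoeff_bind₁]
  | add p q hp hq => simp only [map_add, LinearMap.add_apply, hp, hq]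
  | mul_X p j hp =>
    calc pairing (bind₁ M.transpose.toMvPolynomial (p * X j)) g
        = ∑ i, M i j * pairing (bind₁ M.transpose.toMvPolynomial p) (pderiv i g) := by
          simp only [map_mul, bind₁_X_right, toMvPolynomial_eq_sum, Finset.mul_sum, map_sum,
            LinearMap.sum_apply, Matrix.transpose_apply, ← pairing_X_mul, C_mul',
            mul_smul_comm, map_smul, LinearMap.smul_apply, smul_eq_mul, mul_comm (X _)]
      _ = pairing p (∑ i, C (M i j) * bind₁ M.toMvPolynomial (pderiv i g)) := by
          simp only [hp, map_sum, C_mul', map_smul, smul_eq_mul]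
      _ = pairing (p * X j) (bind₁ M.toMvPolynomial g) := by
          simp only [mul_comm p, pairing_X_mul, pderiv_bind₁, pderiv_toMvPolynomial]

end CommSemiring

theorem pairing_mul_sub [CommRing R] (v u : σ) (f g : MvPolynomial σ R) :
    pairing f ((X v - X u) * g) = pairing (pderiv v f - pderiv u f) g := by
  rw [sub_mul, map_sub, pairing_mul_X, pairing_mul_X, map_sub, LinearMap.sub_apply]

theorem pairing_ne_zero_iff_of_associated [CommRing R] [IsReduced R] {f g h : MvPolynomial σ R}
    (hgh : Associated g h) : pairing f g ≠ 0 ↔ pairing f h ≠ 0 := by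
  obtain ⟨u, rfl⟩ := hgh
  obtain ⟨r, hr, hu⟩ := isUnit_iff_eq_C_of_isReduced.1 u.isUnit
  rw [hu, mul_comm, C_mul', map_smul, smul_eq_mul, Ne, Ne, hr.mul_right_eq_zero]

end Pairing

section RowProduct

variable {m n R : Type*} [Fintype m]

theorem sum_single_apply [DecidableEq n] (p : m → n) (j : n) :
    (∑ i, Finsupp.single (p i) 1 : n →₀ ℕ) j = (Finset.univ.filter fun i => p i = j).card := by
  simp [Finsupp.finsetSum_apply, Finsupp.single_apply]

theorem injective_iff_sum_single_le_one (p : m → n) :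
    p.Injective ↔ ∀ j, (∑ i, Finsupp.single (p i) 1 : n →₀ ℕ) j ≤ 1 := by
  classical
  simp only [sum_single_apply, Finset.card_le_one, Finset.mem_filter_univ]
  exact ⟨fun hp j a ha b hb => hp (ha.trans hb.symm), fun h a b hab => h _ a hab b rfl⟩

theorem exists_perm_comp_eq {c p : m → n} (hc : c.Injective)
    (h : ∑ i, Finsupp.single (p i) 1 = (∑ i, Finsupp.single (c i) 1 : n →₀ ℕ)) :
    ∃ τ : Equiv.Perm m, c ∘ τ = p := by
  classical
  have hp : p.Injective := by
    rwa [injective_iff_sum_single_le_one, h, ← injective_iff_sum_single_le_one]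
  have mem_range (i : m) : ∃ k, c k = p i := by
    have count_pos : 0 < (∑ k, Finsupp.single (c k) 1 : n →₀ ℕ) (p i) := by
      rw [← h, sum_single_apply]
      exact Finset.card_pos.2 ⟨i, by simp⟩
    rw [sum_single_apply] at count_pos
    obtain ⟨k, hk⟩ := Finset.card_pos.1 count_pos
    exact ⟨k, (Finset.mem_filter.1 hk).2⟩
  choose τ hτ using mem_range
  have τ_injective : τ.Injective := fun i k hik => hp (by rw [← hτ, ← hτ, hik])
  exact ⟨.ofBijective τ τ_injective.bijective_of_finite, funext hτ⟩

variable [Fintype n]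

/-- The product of the linear forms given by the rows of a matrix. -/
noncomputable def rowProduct [CommSemiring R] (A : Matrix m n R) : MvPolynomial n R :=
  ∏ i, A.toMvPolynomial i

theorem isHomogeneous_rowProduct [CommSemiring R] (A : Matrix m n R) :
    (rowProduct A).IsHomogeneous (Fintype.card m) := by
  simpa [rowProduct] using IsHomogeneous.prod Finset.univ A.toMvPolynomial (fun _ => 1)
    fun i _ => A.toMvPolynomial_isHomogeneous i

theorem eval_rowProduct [CommSemiring R] (A : Matrix m n R) (f : n → R) :
    eval f (rowProduct A) = ∏ i, (A *ᵥ f) i := by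
  simp only [rowProduct, map_prod, Matrix.toMvPolynomial_eval_eq_apply]

theorem rowProduct_mul [CommSemiring R] {l : Type*} [Fintype l] (M : Matrix l m R)
    (A : Matrix m n R) : rowProduct (M * A) = bind₁ A.toMvPolynomial (rowProduct M) := by
  simp only [rowProduct, map_prod, Matrix.toMvPolynomial_mul]

theorem exists_mulVec_ne_zero [CommRing R] [IsDomain R] (A : Matrix m n R) {S : Finset n}
    (hS : coeff (∑ j ∈ S, Finsupp.single j 1) (rowProduct A) ≠ 0) (L : n → Finset R)
    (hL : ∀ j, 1 < (L j).card) : ∃ f : n → R, (∀ j, f j ∈ L j) ∧ ∀ i, (A *ᵥ f) i ≠ 0 := by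
  have degree_eq : (rowProduct A).totalDegree = (∑ j ∈ S, Finsupp.single j 1 : n →₀ ℕ).degree := by
    have hA := isHomogeneous_rowProduct A
    rw [hA.totalDegree fun h => hS (by rw [h, coeff_zero])]
    by_contra hne
    exact hS (hA.coeff_eq_zero (Ne.symm hne))
  obtain ⟨f, hf, hne⟩ := combinatorial_nullstellensatz_exists_eval_nonzero _ _ hS degree_eq L
    fun j => (sum_single_one_apply_le_one S j).trans_lt (hL j)
  rw [eval_rowProduct, Finset.prod_ne_zero_iff] at hne
  exact ⟨f, hf, fun i => hne i (Finset.mem_univ i)⟩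

variable [DecidableEq m]

theorem coeff_rowProduct [CommSemiring R] (A : Matrix m n R) (t : n →₀ ℕ) :
    coeff t (rowProduct A) =
      ∑ p : m → n with ∑ i, Finsupp.single (p i) 1 = t, ∏ i, A i (p i) := by
  have prod_X (p : m → n) :
      ∏ i, (X (p i) : MvPolynomial n R) = monomial (∑ i, Finsupp.single (p i) 1) 1 :=
    (monomial_sum_one _ _).symm
  simp only [rowProduct, toMvPolynomial_eq_sum, Finset.prod_univ_sum, Fintype.piFinset_univ,
    coeff_sum, Finset.sum_filter, Finset.prod_mul_distrib, ← map_prod, coeff_C_mul, prod_X]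
  classical
  exact Finset.sum_congr rfl fun p _ => by simp [coeff_monomial]

theorem permanent_submatrix_eq_coeff [CommSemiring R] (A : Matrix m n R) {c : m → n}
    (hc : c.Injective) :
    (A.submatrix id c).permanent = coeff (∑ i, Finsupp.single (c i) 1) (rowProduct A) := by
  rw [coeff_rowProduct, ← Matrix.permanent_transpose]
  refine Finset.sum_bij (fun τ _ => c ∘ τ) (fun τ _ => ?_) (fun τ _ τ' _ h => ?_)
    (fun p hp => ?_) fun τ _ => rfl
  · simpa using Equiv.sum_comp τ fun i => Finsupp.single (c i) 1
  · exact Equiv.ext fun i => hc (congrFun h i)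
  · obtain ⟨τ, hτ⟩ := exists_perm_comp_eq hc (Finset.mem_filter.1 hp).2
    exact ⟨τ, Finset.mem_univ _, hτ⟩

theorem exists_permanent_ne_zero [CommSemiring R] (A : Matrix m n R) {S : Finset n}
    (h : coeff (∑ j ∈ S, Finsupp.single j 1) (rowProduct A) ≠ 0) :
    ∃ c : m → n, c.Injective ∧ (A.submatrix id c).permanent ≠ 0 := by
  obtain ⟨c, hc⟩ : ∃ c : m → n, ∑ i, Finsupp.single (c i) 1 = ∑ j ∈ S, Finsupp.single j 1 := by
    rw [coeff_rowProduct] at h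
    obtain ⟨c, hc, -⟩ := Finset.exists_ne_zero_of_sum_ne_zero h
    exact ⟨c, (Finset.mem_filter.1 hc).2⟩
  have c_injective : c.Injective := by
    rw [injective_iff_sum_single_le_one, hc]
    exact sum_single_one_apply_le_one S
  exact ⟨c, c_injective, by rwa [permanent_submatrix_eq_coeff A c_injective, hc]⟩

omit [Fintype n] in
theorem pind_eq_one [DecidableEq n] [Nonempty m] {A : Matrix m n ℝ} {c : m → n} (hc : c.Injective)
    (hA : (A.submatrix id c).permanent ≠ 0) : pind A = 1 := by
  have one_mem : 1 ∈ columnMultiplicities A := by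
    simp only [injective_iff_sum_single_le_one, sum_single_apply] at hc
    exact ⟨c, hA, hc⟩
  refine le_antisymm (mod_cast iInf₂_le 1 one_mem) (le_iInf₂ fun k ⟨d, _, hd⟩ => ?_)
  obtain ⟨i⟩ := ‹Nonempty m›
  have count_pos : 0 < (Finset.univ.filter fun j => d j = d i).card :=
    Finset.card_pos.2 ⟨i, by simp⟩
  exact_mod_cast count_pos.trans_le (hd (d i))

end RowProduct

section Incidence

variable {V : Type*} {G : SimpleGraph V}

/-- The edge joining two adjacent vertices. -/
def edge {u v : V} (h : G.Adj u v) : G.edgeSet := ⟨s(u, v), h⟩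

theorem edge_injective {v u w : V} (hu : G.Adj v u) (hw : G.Adj v w) (h : edge hu = edge hw) :
    u = w :=
  Sym2.congr_right.1 (congrArg Subtype.val h)

theorem Orientation.adj (D : Orientation G) (e : G.edgeSet) : G.Adj (D.tail e) (D.head e) := by
  rw [← SimpleGraph.mem_edgeSet, ← D.ends e]
  exact e.2

theorem exists_orientation (G : SimpleGraph V) : Nonempty (Orientation G) :=
  ⟨⟨fun e => (Quot.out (e : Sym2 V)).1, fun e => (Quot.out (e : Sym2 V)).2,
    fun e => (Quot.out_eq (e : Sym2 V)).symm⟩⟩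

variable [DecidableEq V]

/-- The vertices making up an element of `V ∪ E`: a vertex itself, or both ends of an edge. -/
def endpoints : V ⊕ G.edgeSet → Finset V
  | Sum.inl v => {v}
  | Sum.inr e => (e : Sym2 V).toFinset

theorem endpoints_edge {u v : V} (h : G.Adj u v) : endpoints (Sum.inr (edge h)) = {u, v} :=
  Sym2.toFinset_mk_eq

theorem endpoints_edge_subset_insert {u v : V} {W : Finset V} (h : G.Adj v u) (hu : u ∈ W) :
    endpoints (Sum.inr (edge h)) ⊆ insert v W := by
  rw [endpoints_edge]
  exact Finset.insert_subset_insert v (Finset.singleton_subset_iff.2 hu)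

/-- The linear form dual to a column of `matrixA`: `x_v` for a vertex `v`, and `x_u + x_v` for an
edge `uv`. -/
noncomputable def elementForm (z : V ⊕ G.edgeSet) : MvPolynomial V ℝ := ∑ v ∈ endpoints z, X v

theorem elementForm_inl (v : V) : elementForm (Sum.inl v : V ⊕ G.edgeSet) = X v :=
  Finset.sum_singleton _ _

theorem elementForm_edge {u v : V} (h : G.Adj u v) :
    elementForm (Sum.inr (edge h)) = X u + X v := by
  rw [elementForm, endpoints_edge, Finset.sum_pair h.ne]

variable (G) in
/-- The 0-1 matrix recording which vertices make up which elements of `V ∪ E`; it sends a total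
weighting to the vertex weights. -/
noncomputable def incidence : Matrix V (V ⊕ G.edgeSet) ℝ :=
  Matrix.of fun v z => if v ∈ endpoints z then 1 else 0

/-- The signed edge-vertex incidence matrix of an oriented graph. -/
noncomputable def Orientation.signedIncidence (D : Orientation G) : Matrix G.edgeSet V ℝ :=
  Matrix.of fun e => Pi.single (D.head e) 1 - Pi.single (D.tail e) 1

variable [Fintype V]

theorem incidence_mulVec [DecidableRel G.Adj] (f : V ⊕ G.edgeSet → ℝ) :
    incidence G *ᵥ f = weight G f := by
  ext v
  simp [Matrix.mulVec, dotProduct, incidence, weight, endpoints, Finset.sum_filter]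

theorem Orientation.signedIncidence_mulVec (D : Orientation G) (w : V → ℝ) (e : G.edgeSet) :
    (D.signedIncidence *ᵥ w) e = w (D.head e) - w (D.tail e) := by
  change (Pi.single (D.head e) 1 - Pi.single (D.tail e) 1) ⬝ᵥ w = _
  rw [sub_dotProduct, single_one_dotProduct, single_one_dotProduct]

theorem Orientation.toMvPolynomial_signedIncidence (D : Orientation G) (e : G.edgeSet) :
    D.signedIncidence.toMvPolynomial e = X (D.head e) - X (D.tail e) := by
  simp [toMvPolynomial_eq_sum, signedIncidence, sub_mul, Pi.single_apply]

theorem toMvPolynomial_incidence_transpose :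
    (incidence G).transpose.toMvPolynomial = elementForm := by
  ext1 z
  simp [toMvPolynomial_eq_sum, incidence, elementForm]

theorem matrixA_eq_mul (D : Orientation G) : matrixA D = D.signedIncidence * incidence G := by
  classical
  ext e z
  have hD := (D.adj e).ne
  have mul_apply : (D.signedIncidence * incidence G) e z =
      (if D.head e ∈ endpoints z then 1 else 0) - if D.tail e ∈ endpoints z then 1 else 0 :=
    D.signedIncidence_mulVec (fun v => incidence G v z) e
  rw [mul_apply]
  rcases z with v | f
  · simp only [matrixA, Matrix.of_apply, Meets, endpoints, Finset.mem_singleton]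
    grind
  · simp only [matrixA, Matrix.of_apply, Meets, endpoints, Sym2.mem_toFinset]
    have ends_mem_iff : D.head e ∈ (f : Sym2 V) ∧ D.tail e ∈ (f : Sym2 V) ↔ f = e := by
      rw [Sym2.mem_and_mem_iff hD.symm, Subtype.ext_iff, D.ends e, Sym2.eq_swap]
    grind

theorem coeff_rowProduct_matrixA [DecidableRel G.Adj] (D : Orientation G)
    (S : Finset (V ⊕ G.edgeSet)) :
    coeff (∑ z ∈ S, Finsupp.single z 1) (rowProduct (matrixA D)) =
      pairing (∏ z ∈ S, elementForm z) (rowProduct D.signedIncidence) := by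
  rw [matrixA_eq_mul, rowProduct_mul, ← pairing_prod_X, ← pairing_bind₁_toMvPolynomial,
    toMvPolynomial_incidence_transpose, map_prod]
  simp only [bind₁_X_right]

theorem isChoosable_two_two_of_coeff_ne_zero [DecidableRel G.Adj] (D : Orientation G)
    {S : Finset (V ⊕ G.edgeSet)}
    (hS : coeff (∑ z ∈ S, Finsupp.single z 1) (rowProduct (matrixA D)) ≠ 0) :
    IsChoosable G 2 2 := by
  intro L hL
  have one_lt_card (z) : 1 < (L z).card := by
    rw [hL z]
    cases z <;> exact one_lt_two
  obtain ⟨f, hf, hne⟩ := exists_mulVec_ne_zero _ hS L one_lt_card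
  simp only [matrixA_eq_mul, ← Matrix.mulVec_mulVec, incidence_mulVec,
    D.signedIncidence_mulVec, sub_ne_zero] at hne
  refine ⟨f, hf, fun u v huv => ?_⟩
  have hne := hne (edge huv)
  rcases Sym2.eq_iff.1 (D.ends (edge huv)) with ⟨hu, hv⟩ | ⟨hu, hv⟩
  · rw [← hu, ← hv] at hne
    exact hne.symm
  · rwa [← hu, ← hv] at hne

end Incidence

section InducedSubgraph

variable {V : Type*} {G : SimpleGraph V}

theorem connected_induce_insert [DecidableEq V] {W : Finset V}
    (hW : (G.induce (W : Set V)).Connected) {u v : V} (hu : u ∈ W) (h : G.Adj v u) :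
    (G.induce ((insert v W : Finset V) : Set V)).Connected := by
  rw [Finset.coe_insert, ← Set.union_singleton]
  exact G.connected_induce_union hW.preconnected .of_subsingleton hu rfl h.symm

variable [DecidableRel G.Adj]

variable (G) in
/-- The edges of the subgraph induced by `W`. -/
def edgesIn (W : Finset V) : Finset (Sym2 V) := {e ∈ W.sym2 | e ∈ G.edgeSet}

variable (G) in
/-- The neighbours of `v` that lie in `W`. -/
def neighborsIn (v : V) (W : Finset V) : Finset V := {u ∈ W | G.Adj v u}

theorem mem_neighborsIn {u v : V} {W : Finset V} :
    u ∈ neighborsIn G v W ↔ u ∈ W ∧ G.Adj v u := Finset.mem_filter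

theorem edgesIn_univ [Fintype V] : edgesIn G Finset.univ = G.edgeFinset := by
  ext e
  simp [edgesIn]

theorem edgesIn_singleton (v : V) : edgesIn G {v} = ∅ := by
  simp [edgesIn]

theorem disjoint_map_neighborsIn_edgesIn {v : V} {W : Finset V} (hv : v ∉ W) :
    Disjoint ((neighborsIn G v W).map (Sym2.mkEmbedding v)) (edgesIn G W) := by
  simp [Finset.disjoint_left, edgesIn, hv]

variable [DecidableEq V]

theorem edgesIn_insert {v : V} {W : Finset V} (hv : v ∉ W) :
    edgesIn G (insert v W) =
      ((neighborsIn G v W).map (Sym2.mkEmbedding v)).disjUnion (edgesIn G W)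
        (disjoint_map_neighborsIn_edgesIn hv) := by
  ext e
  induction e with | _ x y
  simp only [edgesIn, neighborsIn, Finset.mem_filter, Finset.mem_disjUnion, Finset.mem_map,
    Finset.mk_mem_sym2_iff, Finset.mem_insert, Sym2.mkEmbedding_apply, SimpleGraph.mem_edgeSet,
    Sym2.eq_iff]
  grind [G.adj_comm x y, G.irrefl]

theorem card_edgesIn_insert {v : V} {W : Finset V} (hv : v ∉ W) :
    (edgesIn G (insert v W)).card = (neighborsIn G v W).card + (edgesIn G W).card := by
  rw [edgesIn_insert hv, Finset.card_disjUnion, Finset.card_map]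

theorem connected_induction {P : Finset V → Prop} {a : V} (singleton : P {a})
    (insert : ∀ (v) (W : Finset V), v ∉ W → a ∈ W → (G.induce (W : Set V)).Connected →
      (neighborsIn G v W).Nonempty → P W → P (insert v W))
    {W : Finset V} (hW : (G.induce (W : Set V)).Connected) (ha : a ∈ W) : P W := by
  let 𝒰 : Set (Finset V) := {U | U ⊆ W ∧ a ∈ U ∧ (G.induce (U : Set V)).Connected ∧ P U}
  have h𝒰 : 𝒰.Finite := W.powerset.finite_toSet.subset fun U hU => Finset.mem_powerset.2 hU.1
  have ha𝒰 : {a} ∈ 𝒰 := by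
    refine ⟨Finset.singleton_subset_iff.2 ha, Finset.mem_singleton_self a, ?_, singleton⟩
    rw [Finset.coe_singleton]
    exact ⟨.of_subsingleton⟩
  obtain ⟨U, ⟨hUW, haU, hU, hPU⟩, hmax⟩ := h𝒰.exists_maximal ⟨_, ha𝒰⟩
  suffices W ⊆ U from this.antisymm hUW ▸ hPU
  by_contra hWU
  obtain ⟨w, hwW, hwU⟩ := Finset.not_subset.1 hWU
  obtain ⟨p⟩ := hW.preconnected ⟨a, ha⟩ ⟨w, hwW⟩
  obtain ⟨⟨⟨⟨u, _⟩, ⟨v, hv⟩⟩, huv⟩, -, hu, hvU⟩ :=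
    p.exists_boundary_dart {x | (x : V) ∈ U} haU hwU
  have hvu : G.Adj v u := SimpleGraph.Adj.symm huv
  refine hvU (hmax ⟨Finset.insert_subset hv hUW, Finset.mem_insert_of_mem haU,
    connected_induce_insert hU hu hvu, insert v U hvU haU hU ⟨u, mem_neighborsIn.2 ⟨hu, hvu⟩⟩ hPU⟩
    (Finset.subset_insert v U) (Finset.mem_insert_self v U))

omit [DecidableEq V] in
theorem card_le_card_edgesIn_add_one {W : Finset V} (hW : (G.induce (W : Set V)).Connected) :
    W.card ≤ (edgesIn G W).card + 1 := by
  classical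
  obtain ⟨⟨a, ha⟩⟩ := hW.nonempty
  refine connected_induction (P := fun W => W.card ≤ (edgesIn G W).card + 1)
    (by simp [edgesIn_singleton]) (fun v W hv _ _ hN ih => ?_) hW ha
  rw [Finset.card_insert_of_notMem hv, card_edgesIn_insert hv]
  have := hN.card_pos
  omega

variable (G) in
/-- `W` induces a tree. -/
def IsTreeOn (W : Finset V) : Prop :=
  (G.induce (W : Set V)).Connected ∧ (edgesIn G W).card + 1 = W.card

theorem tree_induction {P : Finset V → Prop} {a : V} (singleton : P {a})
    (insert : ∀ (u v) (W : Finset V), v ∉ W → a ∈ W → IsTreeOn G W → neighborsIn G v W = {u} → P W →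
      P (insert v W))
    {W : Finset V} (hW : IsTreeOn G W) (ha : a ∈ W) : P W := by
  refine connected_induction
    (P := fun W => (edgesIn G W).card + 1 = W.card → P W) (fun _ => singleton)
    (fun v W hv ha hW hN ih hcard => ?_) hW.1 ha hW.2
  have card_le := card_le_card_edgesIn_add_one hW
  have card_pos := hN.card_pos
  rw [Finset.card_insert_of_notMem hv, card_edgesIn_insert hv] at hcard
  obtain ⟨u, hu⟩ := Finset.card_eq_one.1 (show (neighborsIn G v W).card = 1 by omega)
  have hW : IsTreeOn G W := ⟨hW, by omega⟩
  exact insert u v W hv ha hW hu (ih hW.2)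

end InducedSubgraph

section GraphPolynomial

variable {V : Type*}

/-- The polynomial `X u - X v` of an edge `uv`. Its sign depends on an arbitrary choice of
orientation, so it is only used up to `Associated`. -/
noncomputable def differenceForm (e : Sym2 V) : MvPolynomial V ℝ :=
  X (Quot.out e).1 - X (Quot.out e).2

theorem associated_differenceForm (u v : V) :
    Associated (differenceForm s(u, v)) (X u - X v) := by
  have out_eq : s((Quot.out s(u, v)).1, (Quot.out s(u, v)).2) = s(u, v) := Quot.out_eq _
  rcases Sym2.eq_iff.1 out_eq with ⟨hu, hv⟩ | ⟨hu, hv⟩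
  · rw [differenceForm, hu, hv]
  · rw [differenceForm, hu, hv, ← neg_sub]
    exact (Associated.refl _).neg_left

theorem pderiv_prod_eq_zero {ι R : Type*} [CommSemiring R] {v : V} {l : ι → MvPolynomial V R}
    {F : Finset ι} (h : ∀ i ∈ F, pderiv v (l i) = 0) : pderiv v (∏ i ∈ F, l i) = 0 :=
  Finset.prod_induction l (fun p => pderiv v p = 0)
    (fun p q hp hq => by rw [Derivation.leibniz, hp, hq, smul_zero, smul_zero, add_zero])
    (Derivation.map_one_eq_zero _) h

theorem pderiv_prod_X {R : Type*} [CommSemiring R] {v : V} {W : Finset V} (hv : v ∉ W) :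
    pderiv v (∏ w ∈ W, X w : MvPolynomial V R) = 0 :=
  pderiv_prod_eq_zero fun _ hw => pderiv_X_of_ne (ne_of_mem_of_not_mem hw hv)

variable {G : SimpleGraph V} [DecidableRel G.Adj]

variable (G) in
/-- The graph polynomial of the subgraph induced by `W`, defined up to sign. -/
noncomputable def graphPoly (W : Finset V) : MvPolynomial V ℝ :=
  ∏ e ∈ edgesIn G W, differenceForm e

theorem graphPoly_singleton (v : V) : graphPoly G {v} = 1 := by
  rw [graphPoly, edgesIn_singleton, Finset.prod_empty]

theorem pderiv_graphPoly {v : V} {W : Finset V} (hv : v ∉ W) : pderiv v (graphPoly G W) = 0 := by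
  refine pderiv_prod_eq_zero fun e he => ?_
  have out_mem : ∀ w ∈ e, w ∈ W := Finset.mem_sym2_iff.1 (Finset.mem_filter.1 he).1
  have fst_mem := out_mem _ (Sym2.out_fst_mem e)
  have snd_mem := out_mem _ (Sym2.out_snd_mem e)
  rw [differenceForm, map_sub, pderiv_X_of_ne (ne_of_mem_of_not_mem fst_mem hv),
    pderiv_X_of_ne (ne_of_mem_of_not_mem snd_mem hv), sub_zero]

theorem associated_rowProduct_graphPoly [Fintype V] [DecidableEq V] (D : Orientation G) :
    Associated (rowProduct D.signedIncidence) (graphPoly G Finset.univ) := by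
  rw [rowProduct, graphPoly, edgesIn_univ,
    Finset.prod_subtype _ fun _ => SimpleGraph.mem_edgeFinset]
  refine Associated.prod _ _ _ fun e _ => ?_
  rw [D.toMvPolynomial_signedIncidence, D.ends e, Sym2.eq_swap]
  exact (associated_differenceForm _ _).symm

theorem associated_graphPoly_insert [DecidableEq V] {v : V} {W : Finset V} (hv : v ∉ W) :
    Associated (graphPoly G (insert v W))
      ((∏ u ∈ neighborsIn G v W, (X v - X u)) * graphPoly G W) := by
  rw [graphPoly, edgesIn_insert hv, Finset.prod_disjUnion, Finset.prod_map]
  exact (Associated.prod _ _ _ fun u _ => associated_differenceForm v u).mul_right _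

theorem pairing_graphPoly_eq_zero {u v : V} {W : Finset V} (hu : u ∈ W) (hv : v ∈ W)
    (h : G.Adj u v) {f : MvPolynomial V ℝ} (hf : pderiv u f = pderiv v f) :
    pairing f (graphPoly G W) = 0 := by
  have dvd_graphPoly : X u - X v ∣ graphPoly G W :=
    (associated_differenceForm u v).symm.dvd.trans
      (Finset.dvd_prod_of_mem _ (by simpa [edgesIn, hu, hv] using h))
  obtain ⟨g, hg⟩ := dvd_graphPoly
  rw [hg, pairing_mul_sub, hf, sub_self, map_zero, LinearMap.zero_apply]

section StarProduct

variable {R : Type*} [CommRing R] {v : V} {g : MvPolynomial V R}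

theorem pairing_X_pow_succ_mul_sub {u : V} (h : u ≠ v) (k : ℕ) (f : MvPolynomial V R) :
    pairing (X v ^ (k + 1) * f) ((X v - X u) * g) = (k + 1) * pairing (X v ^ k * f) g +
      pairing (X v ^ (k + 1) * (pderiv v f - pderiv u f)) g := by
  have pderiv_sub : pderiv v (X v ^ (k + 1) * f) - pderiv u (X v ^ (k + 1) * f) =
      (k + 1) • (X v ^ k * f) + X v ^ (k + 1) * (pderiv v f - pderiv u f) := by
    simp only [Derivation.leibniz, Derivation.leibniz_pow, pderiv_X_self, pderiv_X_of_ne h.symm,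
      smul_eq_mul, nsmul_eq_mul, add_tsub_cancel_right, mul_zero]
    ring
  rw [pairing_mul_sub, pderiv_sub, map_add, map_nsmul, LinearMap.add_apply, LinearMap.smul_apply,
    nsmul_eq_mul, Nat.cast_add_one]

theorem pairing_X_pow_mul_prod_eq_zero (hg : pderiv v g = 0) {N : Finset V} (hv : v ∉ N) {k : ℕ}
    (hk : N.card < k) (f : MvPolynomial V R) :
    pairing (X v ^ k * f) ((∏ u ∈ N, (X v - X u)) * g) = 0 := by
  obtain ⟨k, rfl⟩ := Nat.exists_eq_succ_of_ne_zero (Nat.ne_zero_of_lt hk)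
  induction N using Finset.cons_induction generalizing k f with
  | empty => rw [Finset.prod_empty, one_mul, pow_succ', mul_assoc, pairing_X_mul_eq_zero hg]
  | cons u N hu ih =>
    rw [Finset.mem_cons, not_or] at hv
    rw [Finset.card_cons] at hk
    obtain ⟨k, rfl⟩ := Nat.exists_eq_succ_of_ne_zero (show k ≠ 0 by omega)
    rw [Finset.prod_cons, mul_assoc, pairing_X_pow_succ_mul_sub (Ne.symm hv.1),
      ih hv.2 _ _ (by omega), ih hv.2 _ _ (by omega), mul_zero, add_zero]

theorem pairing_X_pow_card_mul_prod (hg : pderiv v g = 0) {N : Finset V} (hv : v ∉ N)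
    (f : MvPolynomial V R) :
    pairing (X v ^ N.card * f) ((∏ u ∈ N, (X v - X u)) * g) = N.card.factorial * pairing f g := by
  induction N using Finset.cons_induction generalizing f with
  | empty => simp
  | cons u N hu ih =>
    rw [Finset.mem_cons, not_or] at hv
    rw [Finset.prod_cons, mul_assoc, Finset.card_cons, pairing_X_pow_succ_mul_sub (Ne.symm hv.1),
      ih hv.2, pairing_X_pow_mul_prod_eq_zero hg hv.2 N.card.lt_succ_self, add_zero,
      Nat.factorial_succ, Nat.cast_mul, Nat.cast_succ, mul_assoc]

end StarProduct

end GraphPolynomial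

section GoodSet

variable {V : Type*} {G : SimpleGraph V}

variable (G) in
/-- The elements by which copies of `v` get replaced in an exchange along its neighbours in `U`:
the vertices `u ∈ U` and the edges `vu`. -/
def exchangeSet (v : V) (U : Finset V) : Set (V ⊕ G.edgeSet) :=
  {z | ∃ u ∈ U, z = Sum.inl u ∨ ∃ h : G.Adj v u, z = Sum.inr (edge h)}

theorem inl_mem_exchangeSet {v w : V} {U : Finset V} :
    Sum.inl w ∈ exchangeSet G v U ↔ w ∈ U := by
  simp [exchangeSet]

theorem edge_mem_exchangeSet {v w : V} (h : G.Adj v w) {U : Finset V} :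
    Sum.inr (edge h) ∈ exchangeSet G v U ↔ w ∈ U := by
  simp only [exchangeSet, Set.mem_ofPred_eq, reduceCtorEq, false_or, Sum.inr.injEq]
  exact ⟨fun ⟨u, hu, hvu, heq⟩ => edge_injective h hvu heq ▸ hu, fun hw => ⟨w, hw, h, rfl⟩⟩

theorem exchangeSet_mono (v : V) {U U' : Finset V} (h : U ⊆ U') :
    exchangeSet G v U ⊆ exchangeSet G v U' :=
  fun _ ⟨u, hu, hz⟩ => ⟨u, h hu, hz⟩

variable [DecidableEq V]

theorem prod_elementForm_map_inl (W : Finset V) :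
    ∏ z ∈ W.map .inl, elementForm (z : V ⊕ G.edgeSet) = ∏ w ∈ W, X w := by
  rw [Finset.prod_map]
  exact Finset.prod_congr rfl fun w _ => elementForm_inl w

theorem pairing_exchange {v u : V} (h : G.Adj v u) {S : Finset (V ⊕ G.edgeSet)}
    (hu : Sum.inl u ∉ S) (hvu : Sum.inr (edge h) ∉ S) {f g : MvPolynomial V ℝ}
    (hg : pairing (X v * f * ∏ z ∈ S, elementForm z) g ≠ 0) :
    pairing (f * ∏ z ∈ insert (Sum.inl u) S, elementForm z) g ≠ 0 ∨
      pairing (f * ∏ z ∈ insert (Sum.inr (edge h)) S, elementForm z) g ≠ 0 := by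
  contrapose! hg
  have X_mul_eq : X v * f * ∏ z ∈ S, elementForm z =
      f * ∏ z ∈ insert (Sum.inr (edge h)) S, elementForm z -
        f * ∏ z ∈ insert (Sum.inl u) S, elementForm z := by
    rw [Finset.prod_insert hu, Finset.prod_insert hvu, elementForm_inl, elementForm_edge]
    ring
  rw [X_mul_eq, map_sub, LinearMap.sub_apply, hg.1, hg.2, sub_zero]

theorem exists_exchange {v : V} {U : Finset V} (hU : ∀ u ∈ U, G.Adj v u)
    {S : Finset (V ⊕ G.edgeSet)} (hS : Disjoint ↑S (exchangeSet G v U)) {g : MvPolynomial V ℝ}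
    (hg : pairing (X v ^ U.card * ∏ z ∈ S, elementForm z) g ≠ 0) :
    ∃ S' : Finset (V ⊕ G.edgeSet), ↑S' ⊆ ↑S ∪ exchangeSet G v U ∧
      pairing (∏ z ∈ S', elementForm z) g ≠ 0 := by
  induction U using Finset.cons_induction generalizing S with
  | empty => exact ⟨S, Set.subset_union_left, by simpa using hg⟩
  | cons u U hu ih =>
    have hvu := hU u (Finset.mem_cons_self u U)
    have inl_mem : Sum.inl u ∈ exchangeSet G v (U.cons u hu) :=
      inl_mem_exchangeSet.2 (Finset.mem_cons_self u U)
    have edge_mem : Sum.inr (edge hvu) ∈ exchangeSet G v (U.cons u hu) :=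
      (edge_mem_exchangeSet hvu).2 (Finset.mem_cons_self u U)
    obtain ⟨z, hz, hzU, hgz⟩ : ∃ z ∈ exchangeSet G v (U.cons u hu), z ∉ exchangeSet G v U ∧
        pairing (X v ^ U.card * ∏ y ∈ insert z S, elementForm y) g ≠ 0 := by
      rw [Finset.card_cons, pow_succ'] at hg
      rcases pairing_exchange hvu (Set.disjoint_right.1 hS inl_mem)
        (Set.disjoint_right.1 hS edge_mem) hg with hg | hg
      · exact ⟨_, inl_mem, fun h => hu (inl_mem_exchangeSet.1 h), hg⟩
      · exact ⟨_, edge_mem, fun h => hu ((edge_mem_exchangeSet hvu).1 h), hg⟩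
    have mono : exchangeSet G v U ⊆ exchangeSet G v (U.cons u hu) :=
      exchangeSet_mono v (Finset.subset_cons hu)
    obtain ⟨S', hS', hgS'⟩ := ih (fun w hw => hU w (Finset.mem_cons_of_mem hw)) (by
      rw [Finset.coe_insert, Set.disjoint_insert_left]
      exact ⟨hzU, hS.mono_right mono⟩) hgz
    rw [Finset.coe_insert, Set.insert_union] at hS'
    exact ⟨S', hS'.trans (Set.insert_subset (Or.inr hz) (Set.union_subset_union_right _ mono)),
      hgS'⟩

variable [DecidableRel G.Adj]

variable (G) in
/-- The elements in `S` belong to the subgraph induced by `W`, and the squarefree monomial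
`∏ z ∈ S, x_z` has a non-zero coefficient in the product of the rows of `matrixA` for this subgraph,
expressed by the pairing as in `coeff_rowProduct_matrixA`. -/
structure IsGood (W : Finset V) (S : Finset (V ⊕ G.edgeSet)) : Prop where
  endpoints_subset : ∀ z ∈ S, endpoints z ⊆ W
  pairing_ne_zero : pairing (∏ z ∈ S, elementForm z) (graphPoly G W) ≠ 0

theorem isGood_union_map_inl {W U : Finset V} (hU : U ⊆ W) {F : Finset (V ⊕ G.edgeSet)}
    (hF : ∀ z ∈ F, endpoints z ⊆ W) (hFU : ∀ u ∈ U, Sum.inl u ∉ F)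
    (h : pairing ((∏ z ∈ F, elementForm z) * ∏ u ∈ U, X u) (graphPoly G W) ≠ 0) :
    IsGood G W (F ∪ U.map .inl) := by
  constructor
  · simp only [Finset.mem_union, Finset.mem_map]
    rintro z (hz | ⟨u, hu, rfl⟩)
    · exact hF z hz
    · exact Finset.singleton_subset_iff.2 (hU hu)
  · have disjoint_map : Disjoint F (U.map .inl) := by
      simpa [Finset.disjoint_right] using hFU
    rwa [Finset.prod_union disjoint_map, prod_elementForm_map_inl]

theorem pairing_graphPoly_insert_ne_zero {v : V} {W : Finset V} (hv : v ∉ W)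
    {f : MvPolynomial V ℝ} (hf : pairing f (graphPoly G W) ≠ 0) :
    pairing (X v ^ (neighborsIn G v W).card * f) (graphPoly G (insert v W)) ≠ 0 := by
  have hvN : v ∉ neighborsIn G v W := fun h => hv (mem_neighborsIn.1 h).1
  rw [pairing_ne_zero_iff_of_associated (associated_graphPoly_insert hv),
    pairing_X_pow_card_mul_prod (pderiv_graphPoly hv) hvN]
  exact mul_ne_zero (Nat.cast_ne_zero.2 (Nat.factorial_ne_zero _)) hf

theorem IsGood.extend {v : V} {W U : Finset V} {S : Finset (V ⊕ G.edgeSet)} (hS : IsGood G W S)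
    (hv : v ∉ W) (hUN : U ⊆ neighborsIn G v W) (hU : U.card + 1 = (neighborsIn G v W).card)
    (hUS : ∀ u ∈ U, Sum.inl u ∉ S) :
    ∃ S', IsGood G (insert v W) S' ∧ ∀ w, Sum.inl w ∈ S' → w = v ∨ w ∈ U ∨ Sum.inl w ∈ S := by
  have hUW (u) (hu : u ∈ U) : u ∈ W := (mem_neighborsIn.1 (hUN hu)).1
  have hUv (u) (hu : u ∈ U) : G.Adj v u := (mem_neighborsIn.1 (hUN hu)).2
  have disjoint_exchangeSet : Disjoint ↑(insert (Sum.inl v) S) (exchangeSet G v U) := by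
    rw [Finset.coe_insert, Set.disjoint_insert_left, inl_mem_exchangeSet]
    refine ⟨fun h => hv (hUW v h), Set.disjoint_right.2 ?_⟩
    rintro _ ⟨u, hu, rfl | ⟨h, rfl⟩⟩ hz
    · exact hUS u hu hz
    · refine hv (hS.endpoints_subset _ hz ?_)
      rw [endpoints_edge]
      exact Finset.mem_insert_self v {u}
  have hvS : Sum.inl v ∉ S := fun h => hv (hS.endpoints_subset _ h (Finset.mem_singleton_self v))
  have pairing_ne_zero := pairing_graphPoly_insert_ne_zero hv hS.pairing_ne_zero
  rw [← hU, pow_succ, mul_assoc, ← elementForm_inl (G := G) v, ← Finset.prod_insert hvS,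
    elementForm_inl] at pairing_ne_zero
  obtain ⟨S', hS', hne⟩ := exists_exchange hUv disjoint_exchangeSet pairing_ne_zero
  rw [Finset.coe_insert] at hS'
  refine ⟨S', ⟨fun z hz => ?_, hne⟩, fun w hw => ?_⟩
  · rcases hS' hz with (rfl | hz) | ⟨u, hu, rfl | ⟨h, rfl⟩⟩
    · simp [endpoints]
    · exact (hS.endpoints_subset z hz).trans (Finset.subset_insert v W)
    · simp [endpoints, hUW u hu]
    · simp [endpoints_edge, Finset.insert_subset_iff, hUW u hu]
  · rcases hS' hw with (h | h) | h
    · exact Or.inl (Sum.inl_injective h)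
    · exact Or.inr (Or.inr h)
    · exact Or.inr (Or.inl (inl_mem_exchangeSet.1 h))

theorem IsGood.extend_leaf {v : V} {W : Finset V} {S : Finset (V ⊕ G.edgeSet)}
    (hS : IsGood G W S) (hv : v ∉ W) (hN : (neighborsIn G v W).card = 1) :
    ∃ S', IsGood G (insert v W) S' ∧ ∀ w, Sum.inl w ∈ S' → w = v ∨ Sum.inl w ∈ S := by
  simpa using hS.extend hv (Finset.empty_subset _) (by rw [hN, Finset.card_empty]) (by simp)

end GoodSet

section Tree

variable {V : Type*} [DecidableEq V] {G : SimpleGraph V} [DecidableRel G.Adj]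

variable (G) in
/-- The coefficient of `∏ w ∈ W \ {r}, x_w` in the graph polynomial on `W`. For a tree it is `±1`:
expanding the product, each edge has to contribute its end farther from `r`. -/
noncomputable def eraseCoeff (W : Finset V) (r : V) : ℝ :=
  pairing (∏ w ∈ W.erase r, X w) (graphPoly G W)

theorem eraseCoeff_eq_neg_of_adj {W : Finset V} {b c : V} (hb : b ∈ W) (hc : c ∈ W)
    (h : G.Adj b c) : eraseCoeff G W c = -eraseCoeff G W b := by
  let Q : MvPolynomial V ℝ := ∏ w ∈ (W.erase b).erase c, X w
  have pderiv_b : pderiv b Q = 0 := pderiv_prod_X (by simp)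
  have pderiv_c : pderiv c Q = 0 := pderiv_prod_X (by simp)
  have pairing_eq_zero : pairing ((X b + X c) * Q) (graphPoly G W) = 0 := by
    refine pairing_graphPoly_eq_zero hb hc h ?_
    simp [Derivation.leibniz, pderiv_b, pderiv_c, pderiv_X_of_ne h.ne, pderiv_X_of_ne h.ne.symm]
  have prod_erase_b : ∏ w ∈ W.erase b, (X w : MvPolynomial V ℝ) = X c * Q :=
    (Finset.mul_prod_erase _ _ (by simp [hc, h.ne.symm])).symm
  have prod_erase_c : ∏ w ∈ W.erase c, (X w : MvPolynomial V ℝ) = X b * Q := by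
    rw [← Finset.mul_prod_erase _ _ (show b ∈ W.erase c by simp [hb, h.ne]),
      Finset.erase_right_comm]
  rw [eraseCoeff, eraseCoeff, eq_neg_iff_add_eq_zero, prod_erase_b, prod_erase_c,
    ← LinearMap.add_apply, ← map_add, ← add_mul, pairing_eq_zero]

theorem IsTreeOn.eraseCoeff_ne_zero {W : Finset V} (hW : IsTreeOn G W) {r : V} (hr : r ∈ W) :
    eraseCoeff G W r ≠ 0 := by
  refine tree_induction (P := fun W => eraseCoeff G W r ≠ 0) ?_
    (fun u v W hv hr _ hN ih => ?_) hW hr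
  · rw [eraseCoeff, graphPoly_singleton, pairing_prod_X]
    simp
  · have hvr : v ≠ r := fun h => hv (h ▸ hr)
    have pairing_ne_zero := pairing_graphPoly_insert_ne_zero hv ih
    rwa [hN, Finset.card_singleton, pow_one, ← Finset.prod_insert (by simp [hv]),
      ← Finset.erase_insert_of_ne hvr] at pairing_ne_zero

omit [DecidableEq V] in
theorem IsTreeOn.not_adj_of_adj_adj {W : Finset V} (hW : IsTreeOn G W) {a b c : V} (ha : a ∈ W)
    (hb : b ∈ W) (hc : c ∈ W) (hab : G.Adj a b) (hbc : G.Adj b c) : ¬G.Adj a c := by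
  classical
  intro hac
  have := eraseCoeff_eq_neg_of_adj ha hb hab
  have := eraseCoeff_eq_neg_of_adj hb hc hbc
  have := eraseCoeff_eq_neg_of_adj ha hc hac
  exact hW.eraseCoeff_ne_zero ha (by linarith)

theorem IsTreeOn.exists_isGood_insert_leaf {W : Finset V} (hW : IsTreeOn G W) {b u v : V}
    (hb : b ∈ W) (hv : v ∉ W) (hN : neighborsIn G v W = {u}) (hub : u ≠ b) :
    ∃ S, IsGood G (insert v W) S ∧ Sum.inl v ∉ S ∧ Sum.inl b ∉ S := by
  obtain ⟨hu, hvu⟩ := mem_neighborsIn.1 (hN ▸ Finset.mem_singleton_self u)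
  let Q : MvPolynomial V ℝ := ∏ w ∈ (W.erase b).erase u, X w
  have pderiv_u : pderiv u Q = 0 := pderiv_prod_X (by simp)
  have pderiv_v : pderiv v Q = 0 := pderiv_prod_X (by simp [hv])
  have prod_erase : ∏ w ∈ W.erase b, (X w : MvPolynomial V ℝ) = X u * Q :=
    (Finset.mul_prod_erase _ _ (by simp [hu, hub])).symm
  have pderiv_sub : pderiv v ((X v + X u) * (X u * Q)) - pderiv u ((X v + X u) * (X u * Q)) =
      -(X u * Q) - X v * Q := by
    simp only [Derivation.leibniz, map_add, pderiv_u, pderiv_v, pderiv_X_self,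
      pderiv_X_of_ne hvu.ne, pderiv_X_of_ne hvu.ne.symm, smul_eq_mul]
    ring
  refine ⟨{Sum.inr (edge hvu)} ∪ (W.erase b).map .inl,
    isGood_union_map_inl ((W.erase_subset b).trans (W.subset_insert v)) ?_ (by simp) ?_,
    by simp [hv], by simp⟩
  · simp [endpoints_edge, Finset.insert_subset_iff, hu]
  · rw [pairing_ne_zero_iff_of_associated (associated_graphPoly_insert hv), hN,
      Finset.prod_singleton, Finset.prod_singleton, elementForm_edge, prod_erase, pairing_mul_sub,
      pderiv_sub, map_sub, LinearMap.sub_apply, pairing_X_mul_eq_zero (pderiv_graphPoly hv),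
      sub_zero, map_neg, LinearMap.neg_apply, neg_ne_zero, ← prod_erase]
    exact hW.eraseCoeff_ne_zero hb

theorem IsTreeOn.exists_isGood_of_not_adj {W : Finset V} (hW : IsTreeOn G W) {a b : V} (ha : a ∈ W)
    (hb : b ∈ W) (hne : a ≠ b) (hab : ¬G.Adj a b) :
    ∃ S, IsGood G W S ∧ Sum.inl a ∉ S ∧ Sum.inl b ∉ S := by
  refine tree_induction (a := b)
    (P := fun W => a ∈ W → ∃ S, IsGood G W S ∧ Sum.inl a ∉ S ∧ Sum.inl b ∉ S)
    (fun ha => absurd (Finset.mem_singleton.1 ha) hne) (fun u v W hv hb hW hN ih ha => ?_) hW hb ha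
  have hvb : b ≠ v := fun h => hv (h ▸ hb)
  obtain rfl | ha := Finset.mem_insert.1 ha
  · refine hW.exists_isGood_insert_leaf hb hv hN ?_
    rintro rfl
    exact hab (mem_neighborsIn.1 (hN ▸ Finset.mem_singleton_self u)).2
  · have hva : a ≠ v := fun h => hv (h ▸ ha)
    obtain ⟨S, hS, haS, hbS⟩ := ih ha
    obtain ⟨S', hS', hmem⟩ := hS.extend_leaf hv (hN ▸ Finset.card_singleton u)
    exact ⟨S', hS', fun h => (hmem a h).elim hva haS, fun h => (hmem b h).elim hvb hbS⟩

end Tree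

section Unicyclic

variable {V : Type*} [DecidableEq V] {G : SimpleGraph V} [DecidableRel G.Adj]

theorem pairing_graphPoly_insert_ne_zero_of_pair {v b c : V} {W : Finset V} (hv : v ∉ W)
    (hN : neighborsIn G v W = {b, c}) (hbc : b ≠ c) {f q r : MvPolynomial V ℝ}
    (hf : pderiv v (pderiv v f - pderiv b f) - pderiv c (pderiv v f - pderiv b f) = q + X v * r)
    (hq : pairing q (graphPoly G W) ≠ 0) : pairing f (graphPoly G (insert v W)) ≠ 0 := by
  rwa [pairing_ne_zero_iff_of_associated (associated_graphPoly_insert hv), hN,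
    Finset.prod_pair hbc, mul_assoc, pairing_mul_sub, pairing_mul_sub, hf, map_add,
    LinearMap.add_apply, pairing_X_mul_eq_zero (pderiv_graphPoly hv), add_zero]

theorem exists_isGood_of_pair {v a : V} {W : Finset V} (ha : a ∈ W) (hv : v ∉ W)
    {y z : V ⊕ G.edgeSet} (hyz : y ≠ z) (hvy : v ∈ endpoints y) (hvz : v ∈ endpoints z)
    (hy : endpoints y ⊆ insert v W) (hz : endpoints z ⊆ insert v W)
    (h : pairing (elementForm y * elementForm z * ∏ w ∈ W.erase a, X w)
      (graphPoly G (insert v W)) ≠ 0) :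
    ∃ S, IsGood G (insert v W) S ∧ Sum.inl a ∉ S := by
  have inl_notMem (w) (hw : w ∈ W) : Sum.inl w ∉ ({y, z} : Finset (V ⊕ G.edgeSet)) := by
    simp only [Finset.mem_insert, Finset.mem_singleton]
    rintro (rfl | rfl)
    · exact hv (Finset.mem_singleton.1 hvy ▸ hw)
    · exact hv (Finset.mem_singleton.1 hvz ▸ hw)
  refine ⟨{y, z} ∪ (W.erase a).map .inl,
    isGood_union_map_inl ((W.erase_subset a).trans (W.subset_insert v)) (by simp [hy, hz])
      (fun w hw => inl_notMem w (Finset.mem_of_mem_erase hw)) ?_, ?_⟩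
  · rwa [Finset.prod_pair hyz]
  · rw [Finset.mem_union, not_or]
    exact ⟨inl_notMem a ha, by simp⟩

theorem IsTreeOn.pairing_triangle_ne_zero {v a c : V} {W : Finset V} (hW : IsTreeOn G W)
    (hv : v ∉ W) (hN : neighborsIn G v W = {a, c}) (hac : G.Adj a c) :
    pairing (X v * (X v + X a) * ∏ w ∈ W.erase a, X w) (graphPoly G (insert v W)) ≠ 0 := by
  obtain ⟨ha, hva⟩ := mem_neighborsIn.1 (show a ∈ neighborsIn G v W by simp [hN])
  obtain ⟨hc, hvc⟩ := mem_neighborsIn.1 (show c ∈ neighborsIn G v W by simp [hN])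
  let Q : MvPolynomial V ℝ := ∏ w ∈ (W.erase a).erase c, X w
  have pderiv_v : pderiv v Q = 0 := pderiv_prod_X (by simp [hv])
  have pderiv_a : pderiv a Q = 0 := pderiv_prod_X (by simp)
  have pderiv_c : pderiv c Q = 0 := pderiv_prod_X (by simp)
  have prod_erase_a : ∏ w ∈ W.erase a, (X w : MvPolynomial V ℝ) = X c * Q :=
    (Finset.mul_prod_erase _ _ (by simp [hc, hac.ne.symm])).symm
  have prod_erase_c : ∏ w ∈ W.erase c, (X w : MvPolynomial V ℝ) = X a * Q := by
    rw [← Finset.mul_prod_erase _ _ (show a ∈ W.erase c by simp [ha, hac.ne]),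
      Finset.erase_right_comm]
  refine pairing_graphPoly_insert_ne_zero_of_pair hv hN hac.ne
    (q := ∏ w ∈ W.erase a, X w - ∏ w ∈ W.erase c, X w) (r := -Q) ?_ ?_
  · simp only [prod_erase_a, prod_erase_c, Derivation.leibniz, map_add, map_sub, pderiv_v, pderiv_a,
      pderiv_c, pderiv_X_self, pderiv_X_of_ne hva.ne, pderiv_X_of_ne hva.ne.symm,
      pderiv_X_of_ne hvc.ne, pderiv_X_of_ne hvc.ne.symm, pderiv_X_of_ne hac.ne,
      pderiv_X_of_ne hac.ne.symm, smul_eq_mul, map_zero, Derivation.map_one_eq_zero]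
    ring
  · rw [map_sub, LinearMap.sub_apply]
    change eraseCoeff G W a - eraseCoeff G W c ≠ 0
    rw [eraseCoeff_eq_neg_of_adj ha hc hac, sub_neg_eq_add, ← two_mul]
    exact mul_ne_zero two_ne_zero (hW.eraseCoeff_ne_zero ha)

theorem IsTreeOn.exists_isGood_triangle {v a c : V} {W : Finset V} (hW : IsTreeOn G W) (hv : v ∉ W)
    (hN : neighborsIn G v W = {a, c}) (hac : G.Adj a c) :
    ∃ S, IsGood G (insert v W) S ∧ Sum.inl a ∉ S := by
  obtain ⟨ha, hva⟩ := mem_neighborsIn.1 (show a ∈ neighborsIn G v W by simp [hN])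
  refine exists_isGood_of_pair ha hv (y := Sum.inl v) (z := Sum.inr (edge hva)) (by simp)
    (by simp [endpoints]) (by simp [endpoints_edge]) (by simp [endpoints])
    (endpoints_edge_subset_insert hva ha) ?_
  rw [elementForm_inl, elementForm_edge]
  exact hW.pairing_triangle_ne_zero hv hN hac

theorem IsTreeOn.pairing_square_ne_zero {v a b c : V} {W : Finset V} (hW : IsTreeOn G W)
    (ha : a ∈ W) (hv : v ∉ W) (hN : neighborsIn G v W = {b, c}) (hbc : b ≠ c) (hab : a ≠ b)
    (hac : a ≠ c) :
    pairing ((X b * X c - X v * X v) * ∏ w ∈ W.erase a, X w) (graphPoly G (insert v W)) ≠ 0 := by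
  obtain ⟨hb, hvb⟩ := mem_neighborsIn.1 (show b ∈ neighborsIn G v W by simp [hN])
  obtain ⟨hc, hvc⟩ := mem_neighborsIn.1 (show c ∈ neighborsIn G v W by simp [hN])
  let Q : MvPolynomial V ℝ := ∏ w ∈ ((W.erase a).erase b).erase c, X w
  have pderiv_v : pderiv v Q = 0 := pderiv_prod_X (by simp [hv])
  have pderiv_b : pderiv b Q = 0 := pderiv_prod_X (by simp)
  have pderiv_c : pderiv c Q = 0 := pderiv_prod_X (by simp)
  have prod_erase : ∏ w ∈ W.erase a, (X w : MvPolynomial V ℝ) = X b * (X c * Q) := by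
    rw [Finset.mul_prod_erase _ _ (by simp [hc, hbc.symm, hac.symm]),
      Finset.mul_prod_erase _ _ (by simp [hb, hab.symm])]
  refine pairing_graphPoly_insert_ne_zero_of_pair hv hN hbc (q := (2 : ℕ) • ∏ w ∈ W.erase a, X w)
    (r := (2 * X b + 2 * X c - X v) * Q) ?_ ?_
  · simp only [prod_erase, Derivation.leibniz, map_add, map_sub, pderiv_v, pderiv_b, pderiv_c,
      pderiv_X_self, pderiv_X_of_ne hvb.ne, pderiv_X_of_ne hvb.ne.symm, pderiv_X_of_ne hvc.ne,
      pderiv_X_of_ne hvc.ne.symm, pderiv_X_of_ne hbc, pderiv_X_of_ne hbc.symm, smul_eq_mul,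
      nsmul_eq_mul, map_zero, Derivation.map_one_eq_zero]
    push_cast
    ring
  · rw [map_nsmul, LinearMap.smul_apply]
    exact smul_ne_zero two_ne_zero (hW.eraseCoeff_ne_zero ha)

theorem IsTreeOn.exists_isGood_square {v a b c : V} {W : Finset V} (hW : IsTreeOn G W)
    (ha : a ∈ W) (hv : v ∉ W) (hN : neighborsIn G v W = {b, c}) (hbc : b ≠ c) (hab : a ≠ b)
    (hac : a ≠ c) : ∃ S, IsGood G (insert v W) S ∧ Sum.inl a ∉ S := by
  obtain ⟨hb, hvb⟩ := mem_neighborsIn.1 (show b ∈ neighborsIn G v W by simp [hN])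
  obtain ⟨hc, hvc⟩ := mem_neighborsIn.1 (show c ∈ neighborsIn G v W by simp [hN])
  by_contra not_good
  have pairing_eq_zero {y z : V ⊕ G.edgeSet} (hyz : y ≠ z) (hvy : v ∈ endpoints y)
      (hvz : v ∈ endpoints z) (hy : endpoints y ⊆ insert v W) (hz : endpoints z ⊆ insert v W) :
      pairing (elementForm y * elementForm z * ∏ w ∈ W.erase a, X w)
        (graphPoly G (insert v W)) = 0 :=
    not_not.1 (mt (exists_isGood_of_pair ha hv hyz hvy hvz hy hz) not_good)
  have mem_inl : v ∈ endpoints (Sum.inl v : V ⊕ G.edgeSet) := Finset.mem_singleton_self v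
  have mem_edge {u : V} (h : G.Adj v u) : v ∈ endpoints (Sum.inr (edge h)) := by
    simp [endpoints_edge]
  have inl_subset : endpoints (Sum.inl v : V ⊕ G.edgeSet) ⊆ insert v W := by simp [endpoints]
  have edge_ne : (Sum.inr (edge hvb) : V ⊕ G.edgeSet) ≠ Sum.inr (edge hvc) :=
    fun h => hbc (edge_injective hvb hvc (Sum.inr_injective h))
  have subset_b := endpoints_edge_subset_insert hvb hb
  have subset_c := endpoints_edge_subset_insert hvc hc
  have X_mul_sub : (X b * X c - X v * X v : MvPolynomial V ℝ) =
      elementForm (Sum.inr (edge hvb)) * elementForm (Sum.inr (edge hvc)) -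
        elementForm (Sum.inl v : V ⊕ G.edgeSet) * elementForm (Sum.inr (edge hvb)) -
        elementForm (Sum.inl v : V ⊕ G.edgeSet) * elementForm (Sum.inr (edge hvc)) := by
    rw [elementForm_inl, elementForm_edge, elementForm_edge]
    ring
  refine hW.pairing_square_ne_zero ha hv hN hbc hab hac ?_
  rw [X_mul_sub, sub_mul, sub_mul, map_sub, map_sub, LinearMap.sub_apply, LinearMap.sub_apply,
    pairing_eq_zero edge_ne (mem_edge hvb) (mem_edge hvc) subset_b subset_c,
    pairing_eq_zero Sum.inl_ne_inr mem_inl (mem_edge hvb) inl_subset subset_b,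
    pairing_eq_zero Sum.inl_ne_inr mem_inl (mem_edge hvc) inl_subset subset_c, sub_zero, sub_zero]

theorem IsTreeOn.exists_isGood_insert_of_mem {v a c : V} {W : Finset V} (hW : IsTreeOn G W)
    (hv : v ∉ W) (hN : neighborsIn G v W = {a, c}) (hac : a ≠ c) :
    ∃ S, IsGood G (insert v W) S ∧ Sum.inl a ∉ S := by
  by_cases h : G.Adj a c
  · exact hW.exists_isGood_triangle hv hN h
  obtain ⟨ha, hva⟩ := mem_neighborsIn.1 (show a ∈ neighborsIn G v W by simp [hN])
  have hc := (mem_neighborsIn.1 (show c ∈ neighborsIn G v W by simp [hN])).1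
  obtain ⟨S, hS, haS, hcS⟩ := hW.exists_isGood_of_not_adj ha hc hac h
  obtain ⟨S', hS', hmem⟩ := hS.extend (U := {c}) hv (by simp [hN]) (by simp [hN, hac])
    (by simp [hcS])
  refine ⟨S', hS', fun h => ?_⟩
  obtain h | h | h := hmem a h
  · exact hva.ne h.symm
  · exact hac (Finset.mem_singleton.1 h)
  · exact haS h

theorem IsTreeOn.exists_isGood_insert_of_card_eq_two {v a : V} {W : Finset V} (hW : IsTreeOn G W)
    (ha : a ∈ W) (hv : v ∉ W) (hN : (neighborsIn G v W).card = 2) :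
    ∃ S, IsGood G (insert v W) S ∧ Sum.inl a ∉ S := by
  obtain ⟨b, c, hbc, hN⟩ := Finset.card_eq_two.1 hN
  obtain rfl | hab := eq_or_ne a b
  · exact hW.exists_isGood_insert_of_mem hv hN hbc
  obtain rfl | hac := eq_or_ne a c
  · exact hW.exists_isGood_insert_of_mem hv (hN.trans (Finset.pair_comm _ _)) hab
  · exact hW.exists_isGood_square ha hv hN hbc hab hac

theorem exists_isGood_of_card_edgesIn_eq {W : Finset V} (hW : (G.induce (W : Set V)).Connected)
    (hcard : (edgesIn G W).card = W.card) {a : V} (ha : a ∈ W) :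
    ∃ S, IsGood G W S ∧ Sum.inl a ∉ S := by
  refine connected_induction (P := fun W => (edgesIn G W).card = W.card →
      ∃ S, IsGood G W S ∧ Sum.inl a ∉ S) (fun h => by simp [edgesIn_singleton] at h)
    (fun v W hv ha hW hN ih hcard => ?_) hW ha hcard
  have hav : a ≠ v := fun h => hv (h ▸ ha)
  have card_le := card_le_card_edgesIn_add_one hW
  have card_pos := hN.card_pos
  rw [Finset.card_insert_of_notMem hv, card_edgesIn_insert hv] at hcard
  obtain hN | hN : (neighborsIn G v W).card = 1 ∨ (neighborsIn G v W).card = 2 := by omega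
  · obtain ⟨S, hS, haS⟩ := ih (by omega)
    obtain ⟨S', hS', hmem⟩ := hS.extend_leaf hv hN
    exact ⟨S', hS', fun h => (hmem a h).elim hav haS⟩
  · exact IsTreeOn.exists_isGood_insert_of_card_eq_two ⟨hW, by omega⟩ ha hv hN

end Unicyclic

section Bicyclic

variable {V : Type*} [DecidableEq V] {G : SimpleGraph V} [DecidableRel G.Adj]

theorem IsTreeOn.exists_isGood_insert_of_card_eq_three {v : V} {W : Finset V} (hW : IsTreeOn G W)
    (hv : v ∉ W) (hN : (neighborsIn G v W).card = 3) : ∃ S, IsGood G (insert v W) S := by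
  obtain ⟨b, c, hb, hc, hbc, not_adj⟩ : ∃ b c, b ∈ neighborsIn G v W ∧ c ∈ neighborsIn G v W ∧
      b ≠ c ∧ ¬G.Adj b c := by
    obtain ⟨x, y, z, hxy, hxz, hyz, hN⟩ := Finset.card_eq_three.1 hN
    have hx : x ∈ neighborsIn G v W := by simp [hN]
    have hy : y ∈ neighborsIn G v W := by simp [hN]
    have hz : z ∈ neighborsIn G v W := by simp [hN]
    by_contra! adj
    exact hW.not_adj_of_adj_adj (mem_neighborsIn.1 hx).1 (mem_neighborsIn.1 hy).1
      (mem_neighborsIn.1 hz).1 (adj x y hx hy hxy) (adj y z hy hz hyz) (adj x z hx hz hxz)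
  obtain ⟨S, hS, hbS, hcS⟩ := hW.exists_isGood_of_not_adj (mem_neighborsIn.1 hb).1
    (mem_neighborsIn.1 hc).1 hbc not_adj
  obtain ⟨S', hS', -⟩ := hS.extend (U := {b, c}) hv (by simp [Finset.insert_subset_iff, hb, hc])
    (by rw [hN, Finset.card_pair hbc]) (by simp [hbS, hcS])
  exact ⟨S', hS'⟩

theorem exists_isGood_insert_of_card_eq_two {v : V} {W : Finset V}
    (hW : (G.induce (W : Set V)).Connected) (hcard : (edgesIn G W).card = W.card) (hv : v ∉ W)
    (hN : (neighborsIn G v W).card = 2) : ∃ S, IsGood G (insert v W) S := by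
  obtain ⟨b, hb⟩ := Finset.card_pos.1 (hN ▸ two_pos)
  obtain ⟨S, hS, hbS⟩ := exists_isGood_of_card_edgesIn_eq hW hcard (mem_neighborsIn.1 hb).1
  obtain ⟨S', hS', -⟩ := hS.extend (U := {b}) hv (by simpa using hb)
    (by rw [hN, Finset.card_singleton]) (by simp [hbS])
  exact ⟨S', hS'⟩

theorem exists_isGood_of_card_edgesIn_eq_add_one {W : Finset V}
    (hW : (G.induce (W : Set V)).Connected) (hcard : (edgesIn G W).card = W.card + 1) :
    ∃ S, IsGood G W S := by
  obtain ⟨⟨a, ha⟩⟩ := hW.nonempty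
  refine connected_induction (P := fun W => (edgesIn G W).card = W.card + 1 → ∃ S, IsGood G W S)
    (fun h => by simp [edgesIn_singleton] at h) (fun v W hv _ hW hN ih hcard => ?_) hW ha hcard
  have card_le := card_le_card_edgesIn_add_one hW
  have card_pos := hN.card_pos
  rw [Finset.card_insert_of_notMem hv, card_edgesIn_insert hv] at hcard
  obtain hN | hN | hN : (neighborsIn G v W).card = 1 ∨ (neighborsIn G v W).card = 2 ∨
      (neighborsIn G v W).card = 3 := by omega
  · obtain ⟨S, hS⟩ := ih (by omega)
    obtain ⟨S', hS', -⟩ := hS.extend_leaf hv hN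
    exact ⟨S', hS'⟩
  · exact exists_isGood_insert_of_card_eq_two hW (by omega) hv hN
  · exact IsTreeOn.exists_isGood_insert_of_card_eq_three ⟨hW, by omega⟩ hv hN

variable [Fintype V]

omit [DecidableEq V] in
theorem IsBicyclic.exists_coeff_ne_zero (hG : IsBicyclic G) (D : Orientation G) :
    ∃ S : Finset (V ⊕ G.edgeSet),
      coeff (∑ z ∈ S, Finsupp.single z 1) (rowProduct (matrixA D)) ≠ 0 := by
  classical
  have connected_univ : (G.induce ((Finset.univ : Finset V) : Set V)).Connected := by
    rw [Finset.coe_univ, (SimpleGraph.induceUnivIso G).connected_iff]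
    exact hG.1
  obtain ⟨S, hS⟩ := exists_isGood_of_card_edgesIn_eq_add_one connected_univ
    (by rw [edgesIn_univ, hG.2, Finset.card_univ])
  refine ⟨S, ?_⟩
  rw [coeff_rowProduct_matrixA,
    pairing_ne_zero_iff_of_associated (associated_rowProduct_graphPoly D)]
  exact hS.pairing_ne_zero

theorem IsBicyclic.pind_eq_one (hG : IsBicyclic G) (D : Orientation G) : pind (matrixA D) = 1 := by
  have edge_nonempty : Nonempty G.edgeSet := by
    rw [Set.nonempty_coe_sort, ← SimpleGraph.coe_edgeFinset, Finset.coe_nonempty,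
      ← Finset.card_pos, hG.2]
    exact Nat.succ_pos _
  obtain ⟨S, hS⟩ := hG.exists_coeff_ne_zero D
  obtain ⟨c, hc, hA⟩ := exists_permanent_ne_zero (matrixA D) hS
  exact TotalWeight.pind_eq_one hc hA

end Bicyclic

end TotalWeight

theorem theorem3p3 {V : Type*} [Fintype V] [DecidableEq V] (B : SimpleGraph V)
    [DecidableRel B.Adj] (hB : TotalWeight.IsBicyclic B) :
    (∀ D : TotalWeight.Orientation B, TotalWeight.pind (TotalWeight.matrixA D) = 1) ∧
      TotalWeight.IsChoosable B 2 2 := by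
  refine ⟨hB.pind_eq_one, ?_⟩
  obtain ⟨D⟩ := TotalWeight.exists_orientation B
  obtain ⟨S, hS⟩ := hB.exists_coeff_ne_zero D
  exact TotalWeight.isChoosable_two_two_of_coeff_ne_zero D hS
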